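/- Let $R$ be a commutative ring with identity, let $E=(E^0,E^1,r,s)$ be a directed graph ($E^0$ and $E^1$ arbitrary sets, $r,s\colon E^1\to E^0$), and let $G$ be a group with identity $e$. The Leavitt path algebra $L=L_R(E)$ is the associative, not necessarily unital, $R$-algebra generated by pairwise orthogonal idempotents $v$ $(v\in E^0)$ and elements $f,f^*$ $(f\in E^1)$ subject to $s(f)f=fr(f)=f$ and $r(f)f^*=f^*s(f)=f^*$ for $f\in E^1$, $f^*f'=\delta_{f,f'}r(f)$ for $f,f'\in E^1$, and $v=\sum_{s(f)=v}ff^*$ for every $v\in E^0$ for which $s^{-1}(v)$ is non-empty and finite. Let $d\colon E^1\to G$ be any map, and let $L$ carry the corresponding standard $G$-grading: $\deg v=e$, $\deg f=d(f)$, $\deg f^*=d(f)^{-1}$, and the component $L_g$ $(g\in G)$ is the $R$-span of all products of generators whose degrees multiply to $g$. For a path $\alpha=f_1\cdots f_n$ put $\alpha^*=f_n^*\cdots f_1^*$ and $\partial(\alpha)=d(f_1)\cdots d(f_n)$; for a path of length zero (a vertex) $\alpha=v$ put $v^*=v$ and $\partial(v)=e$; and put $\partial(\alpha\beta^*)=\partial(\alpha)\partial(\beta)^{-1}$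 for paths $\alpha,\beta$. For additive subgroups $A,B$ of $L$ let $AB$ be the additive subgroup generated by the products $ab$ with $a\in A$, $b\in B$. Then $L=\bigoplus_{g\in G}L_g$ with $L_gL_h\subseteq L_{gh}$ for all $g,h\in G$, and $$L_g=\operatorname{span}_R\{\alpha\beta^* : \alpha,\beta \text{ paths in } E,\ \partial(\alpha\beta^*)=g\}\qquad (g\in G).$$ Moreover, the following assertions are equivalent. (i) $L$ is epsilon-strongly graded: $L$ has an identity element, and for every $g\in G$ the $(L_gL_{g^{-1}},L_{g^{-1}}L_g)$-bimodule $L_g$ is unital, that is, there are $\epsilon\in L_gL_{g^{-1}}$ and $\epsilon'\in L_{g^{-1}}L_g$ with $\epsilon s=s=s\epsilon'$ for all $s\in L_g$. (ii) For every $g\in G$, the component $L_g$ is finitely generated as a left module over the principal component $L_e$ (for the possibly non-unital ring $L_e$ this means that there is a finite set $F\subseteq L_g$ such that $L_g$ is generated as an additive group by the elements $x$ and $ax$ with $x\in F$, $a\in L_e$). In particular, (i) holds whenever every $L_g$ is finitely generated as a module over the coefficient ring $R$. -/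

import Mathlib

/-- A directed graph `E = (E⁰, E¹, r, s)`: a set of vertices, a set of edges, and the source and
range maps. -/
structure DirectedGraph.{u, v} where
  /-- The set `E⁰` of vertices. -/
  Vert : Type u
  /-- The set `E¹` of edges. -/
  Edge : Type v
  /-- The source map `s`. -/
  src : Edge → Vert
  /-- The range map `r`. -/
  rng : Edge → Vert

namespace DirectedGraph

/-- The arrows from `a` to `b` are the edges with source `a` and range `b`. Thus
`Quiver.Path a b` is the type of directed paths from `a` to `b`, the path of length zero at a
vertex `a = b` included. -/
instance (E : DirectedGraph) : Quiver E.Vert :=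
  ⟨fun a b => {f : E.Edge // E.src f = a ∧ E.rng f = b}⟩

/-- The generating symbols of the Leavitt path algebra: `v`, `f` and `f*`. -/
inductive Gen (E : DirectedGraph) : Type _
  | vert (v : E.Vert) : Gen E
  | edge (f : E.Edge) : Gen E
  | ghost (f : E.Edge) : Gen E

end DirectedGraph

namespace Leavitt

open DirectedGraph

noncomputable section

/-- The free associative, not necessarily unital `R`-algebra on the symbols `v`, `f`, `f*`: its
`R`-basis is the set of all nonempty words in these symbols. -/
abbrev FreeAlg (R : Type*) [CommRing R] (E : DirectedGraph) : Type _ :=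
  MonoidAlgebra R (FreeSemigroup E.Gen)

/-- The word of length one given by a symbol, in the free algebra. -/
def sym (R : Type*) [CommRing R] {E : DirectedGraph} (x : E.Gen) : FreeAlg R E :=
  MonoidAlgebra.single (FreeSemigroup.of x) 1

/-- The defining relations of the Leavitt path algebra, and their multiples by scalars. -/
inductive Rel (R : Type*) [CommRing R] (E : DirectedGraph) : FreeAlg R E → FreeAlg R E → Prop
  | vert_idem (v : E.Vert) : Rel R E (sym R (.vert v) * sym R (.vert v)) (sym R (.vert v))
  | vert_orth (v w : E.Vert) (h : v ≠ w) : Rel R E (sym R (.vert v) * sym R (.vert w)) 0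
  | src_edge (f : E.Edge) :
      Rel R E (sym R (.vert (E.src f)) * sym R (.edge f)) (sym R (.edge f))
  | edge_rng (f : E.Edge) :
      Rel R E (sym R (.edge f) * sym R (.vert (E.rng f))) (sym R (.edge f))
  | rng_ghost (f : E.Edge) :
      Rel R E (sym R (.vert (E.rng f)) * sym R (.ghost f)) (sym R (.ghost f))
  | ghost_src (f : E.Edge) :
      Rel R E (sym R (.ghost f) * sym R (.vert (E.src f))) (sym R (.ghost f))
  | ghost_edge_self (f : E.Edge) :
      Rel R E (sym R (.ghost f) * sym R (.edge f)) (sym R (.vert (E.rng f)))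
  | ghost_edge_ne (f f' : E.Edge) (h : f ≠ f') :
      Rel R E (sym R (.ghost f) * sym R (.edge f')) 0
  | vert_sum (v : E.Vert) (hfin : {f : E.Edge | E.src f = v}.Finite)
      (hne : {f : E.Edge | E.src f = v}.Nonempty) :
      Rel R E (sym R (.vert v)) (∑ f ∈ hfin.toFinset, sym R (.edge f) * sym R (.ghost f))
  | smul (c : R) {a b : FreeAlg R E} : Rel R E a b → Rel R E (c • a) (c • b)

/-- The congruence (equivalently, two-sided ideal) generated by the relations. -/
def con (R : Type*) [CommRing R] (E : DirectedGraph) : RingCon (FreeAlg R E) :=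
  ringConGen (Rel R E)

theorem con_smul {R : Type*} [CommRing R] {E : DirectedGraph} (c : R) {a b : FreeAlg R E}
    (h : con R E a b) : con R E (c • a) (c • b) := by
  change RingConGen.Rel (Rel R E) a b at h
  change RingConGen.Rel (Rel R E) (c • a) (c • b)
  induction h with
  | of x y h => exact .of _ _ (.smul c h)
  | refl x => exact .refl _
  | symm _ ih => exact .symm ih
  | trans _ _ ih₁ ih₂ => exact .trans ih₁ ih₂
  | add _ _ ih₁ ih₂ => rw [smul_add, smul_add]; exact .add ih₁ ih₂
  | mul _ h₂ ih₁ _ => rw [← smul_mul_assoc, ← smul_mul_assoc]; exact .mul ih₁ h₂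

end

end Leavitt

/-- The Leavitt path algebra `L_R(E)`: the `R`-algebra, in general without identity, presented by
the generators `v`, `f`, `f*` and the Leavitt relations. -/
def LeavittPathAlgebra (R : Type*) [CommRing R] (E : DirectedGraph) : Type _ :=
  (Leavitt.con R E).Quotient

namespace LeavittPathAlgebra

open DirectedGraph

noncomputable section

instance (R : Type*) [CommRing R] (E : DirectedGraph) : NonUnitalRing (LeavittPathAlgebra R E) :=
  inferInstanceAs (NonUnitalRing (Leavitt.con R E).Quotient)

/-- The quotient map from the free algebra onto `L_R(E)`. -/
def mk (R : Type*) [CommRing R] (E : DirectedGraph) (a : Leavitt.FreeAlg R E) :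
    LeavittPathAlgebra R E :=
  ((a : (Leavitt.con R E).Quotient) : (Leavitt.con R E).Quotient)

instance (R : Type*) [CommRing R] (E : DirectedGraph) : SMul R (LeavittPathAlgebra R E) :=
  ⟨fun c => Quotient.map (fun a => c • a) (fun _ _ h => Leavitt.con_smul c h)⟩

theorem mk_surjective (R : Type*) [CommRing R] (E : DirectedGraph) :
    Function.Surjective (mk R E) :=
  fun x => Quotient.inductionOn x fun a => ⟨a, rfl⟩

instance (R : Type*) [CommRing R] (E : DirectedGraph) : Module R (LeavittPathAlgebra R E) where
  one_smul x := by
    obtain ⟨a, rfl⟩ := mk_surjective R E x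
    exact congrArg (mk R E) (one_smul R a)
  mul_smul c d x := by
    obtain ⟨a, rfl⟩ := mk_surjective R E x
    exact congrArg (mk R E) (mul_smul c d a)
  smul_zero c := congrArg (mk R E) (smul_zero c)
  smul_add c x y := by
    obtain ⟨a, rfl⟩ := mk_surjective R E x
    obtain ⟨b, rfl⟩ := mk_surjective R E y
    exact congrArg (mk R E) (smul_add c a b)
  add_smul c d x := by
    obtain ⟨a, rfl⟩ := mk_surjective R E x
    exact congrArg (mk R E) (add_smul c d a)
  zero_smul x := by
    obtain ⟨a, rfl⟩ := mk_surjective R E x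
    exact congrArg (mk R E) (zero_smul R a)

instance (R : Type*) [CommRing R] (E : DirectedGraph) :
    IsScalarTower R (LeavittPathAlgebra R E) (LeavittPathAlgebra R E) where
  smul_assoc c x y := by
    obtain ⟨a, rfl⟩ := mk_surjective R E x
    obtain ⟨b, rfl⟩ := mk_surjective R E y
    exact congrArg (mk R E) (smul_mul_assoc c a b)

instance (R : Type*) [CommRing R] (E : DirectedGraph) :
    SMulCommClass R (LeavittPathAlgebra R E) (LeavittPathAlgebra R E) where
  smul_comm c x y := by
    obtain ⟨a, rfl⟩ := mk_surjective R E x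
    obtain ⟨b, rfl⟩ := mk_surjective R E y
    exact congrArg (mk R E) (mul_smul_comm c a b).symm

/-- The generator `v`, `f` or `f*` of `L_R(E)`. -/
def gen (R : Type*) [CommRing R] {E : DirectedGraph} (x : E.Gen) : LeavittPathAlgebra R E :=
  mk R E (Leavitt.sym R x)

/-- The element of `L_R(E)` given by a path `α`: the vertex `v` for the path of length zero at
`v`, and `f₁ f₂ ⋯ fₙ` for a path with edges `f₁, …, fₙ` (the leading factor `s(f₁)` changes
nothing). -/
def ofPath (R : Type*) [CommRing R] {E : DirectedGraph} {a : E.Vert} :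
    {b : E.Vert} → Quiver.Path a b → LeavittPathAlgebra R E
  | _, .nil => gen R (.vert a)
  | _, .cons p f => ofPath R p * gen R (.edge f.1)

/-- The element `α* = fₙ* ⋯ f₁*` of `L_R(E)` given by a path `α = f₁ ⋯ fₙ`, with `v* = v` for the
path of length zero at `v`. -/
def ofGhostPath (R : Type*) [CommRing R] {E : DirectedGraph} {a : E.Vert} :
    {b : E.Vert} → Quiver.Path a b → LeavittPathAlgebra R E
  | _, .nil => gen R (.vert a)
  | _, .cons p f => gen R (.ghost f.1) * ofGhostPath R p

/-- The degree of a generating symbol determined by degrees `d f` of the edges: `v` has degree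
`e`, `f` has degree `d f` and `f*` has degree `(d f)⁻¹`. -/
def genDegree {E : DirectedGraph} {G : Type*} [Group G] (d : E.Edge → G) : E.Gen → G
  | .vert _ => 1
  | .edge f => d f
  | .ghost f => (d f)⁻¹

/-- The degree of a path: `e` for a vertex, `d f₁ ⋯ d fₙ` for `f₁ ⋯ fₙ`. -/
def pathDegree {E : DirectedGraph} {G : Type*} [Group G] (d : E.Edge → G) {a : E.Vert} :
    {b : E.Vert} → Quiver.Path a b → G
  | _, .nil => 1
  | _, .cons p f => pathDegree d p * d f.1

/-- The homogeneous component of degree `g` of the standard `G`-grading of `L_R(E)` determined by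
`d : E¹ → G`: the image of the component of degree `g` of the free algebra, that is, the `R`-span
of the products of generators whose degrees multiply to `g`. -/
def component (R : Type*) [CommRing R] {E : DirectedGraph} {G : Type*} [Group G]
    (d : E.Edge → G) (g : G) : Submodule R (LeavittPathAlgebra R E) :=
  Submodule.span R
    {x | ∃ w : FreeSemigroup E.Gen, FreeSemigroup.lift (genDegree d) w = g ∧
      FreeSemigroup.lift (gen R) w = x}

/-- The elements of `L_R(E)` given by the formal expressions `αβ*` of degree `g`, where `α` and
`β` are paths in `E`. -/
def monomials (R : Type*) [CommRing R] {E : DirectedGraph} {G : Type*} [Group G]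
    (d : E.Edge → G) (g : G) : Set (LeavittPathAlgebra R E) :=
  {x | ∃ (a b a' b' : E.Vert) (α : Quiver.Path a b) (β : Quiver.Path a' b'),
    pathDegree d α * (pathDegree d β)⁻¹ = g ∧ ofPath R α * ofGhostPath R β = x}

end

end LeavittPathAlgebra

/-- The additive subgroup `A B` of finite sums of products `a b` with `a ∈ A` and `b ∈ B`. -/
def addSubgroupProd {S : Type*} [NonUnitalRing S] (A B : AddSubgroup S) : AddSubgroup S :=
  AddSubgroup.closure {x | ∃ a ∈ A, ∃ b ∈ B, a * b = x}

/-- `S` is graded by the group `G` with homogeneous components `𝒮 g`: `S = ⨁ 𝒮 g` and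
`𝒮 g 𝒮 h ⊆ 𝒮 (g h)`. -/
structure IsGroupGrading {S : Type*} [NonUnitalRing S] {G : Type*} [Group G]
    (𝒮 : G → AddSubgroup S) : Prop where
  indep : iSupIndep 𝒮
  iSup_eq_top : ⨆ g, 𝒮 g = ⊤
  mul_mem : ∀ {g h : G} {x y : S}, x ∈ 𝒮 g → y ∈ 𝒮 h → x * y ∈ 𝒮 (g * h)

/-- For `A`, `B` acting on `M` by left and right multiplication, the `(A, B)`-bimodule `M` is
unital: some element of `A` is a left identity on `M` and some element of `B` is a right identity
on `M`. -/
def IsUnitalBimodule {S : Type*} [NonUnitalRing S] (A B M : AddSubgroup S) : Prop :=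
  (∃ e ∈ A, ∀ m ∈ M, e * m = m) ∧ ∃ e ∈ B, ∀ m ∈ M, m * e = m

/-- `S`, graded by `G` with components `𝒮 g`, is epsilon-strongly graded: it has an identity
element, and each `𝒮 g` is a unital `(𝒮 g 𝒮 g⁻¹, 𝒮 g⁻¹ 𝒮 g)`-bimodule. -/
structure IsEpsilonStronglyGraded {S : Type*} [NonUnitalRing S] {G : Type*} [Group G]
    (𝒮 : G → AddSubgroup S) : Prop where
  grading : IsGroupGrading 𝒮
  unital : ∃ u : S, ∀ x : S, u * x = x ∧ x * u = x
  unital_bimodule : ∀ g : G,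
    IsUnitalBimodule (addSubgroupProd (𝒮 g) (𝒮 g⁻¹)) (addSubgroupProd (𝒮 g⁻¹) (𝒮 g)) (𝒮 g)

/-- `M` is finitely generated as a left `A`-module, for a possibly non-unital ring `A` acting by
left multiplication: there is a finite `F ⊆ M` such that `M` is generated as an additive group by
the elements `x` and `a x` with `x ∈ F` and `a ∈ A`. -/
def IsLeftFinitelyGenerated {S : Type*} [NonUnitalRing S] (A M : AddSubgroup S) : Prop :=
  ∃ F : Finset S, M = AddSubgroup.closure ((F : Set S) ∪ {y | ∃ a ∈ A, ∃ x ∈ F, a * x = y})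

/-!
The components of the standard grading are independent because the defining relations are
homogeneous. This is expressed by the coaction `x ↦ x · deg x` into a group ring of `G`, which is
defined on the free algebra and respects the relations (`freeCoaction_eq_of_rel`); the coefficient
at `g` of the image of `x` recovers the component of `x` of degree `g`. The components are spanned
by the monomials `p q*` because multiplying a monomial by a generator gives zero or again a monomial
(`gen_mul_mem_span_monomials`).

For the equivalence, the point is that each component always has *local* identities. A monomial
`p q*` with nonzero value is fixed by `p p*` on the left and by `q q*` on the right. The idempotents
`p p*` commute (`ofPath_mul_ofGhostPath_commute`), so if `e₁` and `e₂` are local identities of `x`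
and `y` in the ring they generate, `e₁ + e₂ - e₁ e₂` is one of both; hence each finite subset of
`L_g` has a left identity in `L_g L_{g⁻¹}` and a right identity in `L_{g⁻¹} L_g`. If `L_g` is
finitely generated as a left module over `L_e`, or over the coefficient ring, a right identity of
the generators is one of `L_g`. Left identities follow: if `ε` in `L_g L_{g⁻¹}` is a right
identity of `L_{g⁻¹}`, then `e ε = e` for all `e` in `L_g L_{g⁻¹}`; choosing for `e` a left identity
of both `ε` and a given `x` in `L_g`, we get `e = e ε = ε`, so that `ε x = x`
(`left_unit_of_right_unit`). Finally an identity of `L_e` fixes every vertex, and so is an identity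
of the algebra.

Conversely, writing the right identity of `L_g` as `Σ aᵢ bᵢ` with
`aᵢ` in `L_{g⁻¹}` and `bᵢ` in `L_g`, we have `s = Σ (s aᵢ) bᵢ`, so that the `bᵢ` generate `L_g`.
-/

namespace LeavittPathAlgebra

open DirectedGraph

/-! ### The defining relations -/

section Relations

variable (R : Type*) [CommRing R] {E : DirectedGraph}

/-- The quotient map as a homomorphism of non-unital `R`-algebras. -/
noncomputable def mkHom (E : DirectedGraph) :
    Leavitt.FreeAlg R E →ₙₐ[R] LeavittPathAlgebra R E where
  toFun := mk R E
  map_smul' _ _ := rfl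
  map_zero' := rfl
  map_add' _ _ := rfl
  map_mul' _ _ := rfl

theorem mkHom_sym (x : E.Gen) : mkHom R E (Leavitt.sym R x) = gen R x := rfl

theorem mkHom_eq_of_rel {a b : Leavitt.FreeAlg R E} (h : Leavitt.Rel R E a b) :
    mkHom R E a = mkHom R E b :=
  Quotient.sound (RingConGen.Rel.of _ _ h)

theorem vert_mul_self (v : E.Vert) : gen R (.vert v) * gen R (.vert v) = gen R (.vert v) := by
  simpa only [map_mul, mkHom_sym] using mkHom_eq_of_rel R (.vert_idem v)

theorem vert_mul_of_ne {v w : E.Vert} (h : v ≠ w) : gen R (.vert v) * gen R (.vert w) = 0 := by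
  simpa only [map_mul, map_zero, mkHom_sym] using mkHom_eq_of_rel R (.vert_orth v w h)

theorem src_mul_edge (f : E.Edge) :
    gen R (.vert (E.src f)) * gen R (.edge f) = gen R (.edge f) := by
  simpa only [map_mul, mkHom_sym] using mkHom_eq_of_rel R (.src_edge f)

theorem edge_mul_rng (f : E.Edge) :
    gen R (.edge f) * gen R (.vert (E.rng f)) = gen R (.edge f) := by
  simpa only [map_mul, mkHom_sym] using mkHom_eq_of_rel R (.edge_rng f)

theorem rng_mul_ghost (f : E.Edge) :
    gen R (.vert (E.rng f)) * gen R (.ghost f) = gen R (.ghost f) := by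
  simpa only [map_mul, mkHom_sym] using mkHom_eq_of_rel R (.rng_ghost f)

theorem ghost_mul_src (f : E.Edge) :
    gen R (.ghost f) * gen R (.vert (E.src f)) = gen R (.ghost f) := by
  simpa only [map_mul, mkHom_sym] using mkHom_eq_of_rel R (.ghost_src f)

theorem ghost_mul_edge_self (f : E.Edge) :
    gen R (.ghost f) * gen R (.edge f) = gen R (.vert (E.rng f)) := by
  simpa only [map_mul, mkHom_sym] using mkHom_eq_of_rel R (.ghost_edge_self f)

theorem ghost_mul_edge_of_ne {f f' : E.Edge} (h : f ≠ f') :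
    gen R (.ghost f) * gen R (.edge f') = 0 := by
  simpa only [map_mul, map_zero, mkHom_sym] using mkHom_eq_of_rel R (.ghost_edge_ne f f' h)

theorem vert_eq_sum (v : E.Vert) (hfin : {f : E.Edge | E.src f = v}.Finite)
    (hne : {f : E.Edge | E.src f = v}.Nonempty) :
    gen R (.vert v) = ∑ f ∈ hfin.toFinset, gen R (.edge f) * gen R (.ghost f) := by
  simpa only [map_mul, map_sum, mkHom_sym] using mkHom_eq_of_rel R (.vert_sum v hfin hne)

theorem mkHom_single (w : FreeSemigroup E.Gen) (c : R) :
    mkHom R E (MonoidAlgebra.single w c) = c • FreeSemigroup.lift (gen R) w := by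
  have h : ∀ w : FreeSemigroup E.Gen,
      mkHom R E (MonoidAlgebra.single w 1) = FreeSemigroup.lift (gen R) w := by
    intro w
    induction w with
    | ih1 x => rfl
    | ih2 x y hx hy =>
      rw [map_mul, ← hx, ← hy, ← map_mul, MonoidAlgebra.single_mul_single, one_mul]
  rw [← h, ← map_smul, MonoidAlgebra.smul_single, smul_eq_mul, mul_one]

end Relations

/-! ### The standard grading -/

section Grading

variable (R : Type*) [CommRing R] {E : DirectedGraph} {G : Type*} [Group G] (d : E.Edge → G)

theorem lift_gen_mem_component (w : FreeSemigroup E.Gen) :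
    FreeSemigroup.lift (gen R) w ∈ component R d (FreeSemigroup.lift (genDegree d) w) :=
  Submodule.subset_span ⟨w, rfl, rfl⟩

theorem gen_mem_component (x : E.Gen) : gen R x ∈ component R d (genDegree d x) :=
  lift_gen_mem_component R d (.of x)

variable {R d}

theorem mul_mem_component {g h : G} {x y : LeavittPathAlgebra R E}
    (hx : x ∈ component R d g) (hy : y ∈ component R d h) : x * y ∈ component R d (g * h) := by
  induction hx using Submodule.span_induction with
  | zero => rw [zero_mul]; exact zero_mem _
  | add _ _ _ _ h₁ h₂ => rw [add_mul]; exact add_mem h₁ h₂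
  | smul c _ _ h₁ => rw [smul_mul_assoc]; exact Submodule.smul_mem _ c h₁
  | mem _ hx =>
    obtain ⟨w, rfl, rfl⟩ := hx
    induction hy using Submodule.span_induction with
    | zero => rw [mul_zero]; exact zero_mem _
    | add _ _ _ _ h₁ h₂ => rw [mul_add]; exact add_mem h₁ h₂
    | smul c _ _ h₁ => rw [mul_smul_comm]; exact Submodule.smul_mem _ c h₁
    | mem _ hy =>
      obtain ⟨w', rfl, rfl⟩ := hy
      rw [← map_mul, ← map_mul]
      exact lift_gen_mem_component R d (w * w')

variable (R d)

/-- The grading as a coaction, on the free algebra: the homomorphism to the group ring of `G` with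
coefficients in the unitization of `L_R(E)` which sends a symbol `x` to `x` times the group element
`deg x`. -/
noncomputable def freeCoaction :
    Leavitt.FreeAlg R E →ₙₐ[R] MonoidAlgebra (Unitization R (LeavittPathAlgebra R E)) G :=
  MonoidAlgebra.liftMagma R <| FreeSemigroup.lift fun x =>
    MonoidAlgebra.single (genDegree d x) (Unitization.inr (gen R x))

theorem freeCoaction_single (w : FreeSemigroup E.Gen) (c : R) :
    freeCoaction R d (MonoidAlgebra.single w c) =
      MonoidAlgebra.single (FreeSemigroup.lift (genDegree d) w)
        (Unitization.inr (c • FreeSemigroup.lift (gen R) w)) := by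
  have h : FreeSemigroup.lift (fun x : E.Gen => MonoidAlgebra.single (genDegree d x)
        (Unitization.inr (gen R x) : Unitization R (LeavittPathAlgebra R E))) w =
      MonoidAlgebra.single (FreeSemigroup.lift (genDegree d) w)
        (Unitization.inr (FreeSemigroup.lift (gen R) w)) := by
    induction w with
    | ih1 x => rfl
    | ih2 x y hx hy =>
      rw [map_mul, map_mul, map_mul, hx, hy, MonoidAlgebra.single_mul_single,
        Unitization.inr_mul]
  rw [freeCoaction, MonoidAlgebra.liftMagma_apply_apply]
  simp [h, MonoidAlgebra.smul_single]

theorem freeCoaction_sym (x : E.Gen) :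
    freeCoaction R d (Leavitt.sym R x) =
      MonoidAlgebra.single (genDegree d x) (Unitization.inr (gen R x)) := by
  rw [Leavitt.sym, freeCoaction_single, one_smul, FreeSemigroup.lift_of, FreeSemigroup.lift_of]

/-- The defining relations are homogeneous. -/
theorem freeCoaction_eq_of_rel {a b : Leavitt.FreeAlg R E} (h : Leavitt.Rel R E a b) :
    freeCoaction R d a = freeCoaction R d b := by
  induction h with
  | smul c _ ih => rw [map_smul, map_smul, ih]
  | vert_sum v hfin hne =>
    have hsum : ∀ f : E.Edge,
        freeCoaction R d (Leavitt.sym R (.edge f) * Leavitt.sym R (.ghost f)) =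
        MonoidAlgebra.single 1 (Unitization.inr (gen R (.edge f) * gen R (.ghost f))) := by
      intro f
      rw [map_mul, freeCoaction_sym, freeCoaction_sym, MonoidAlgebra.single_mul_single,
        ← Unitization.inr_mul, genDegree, genDegree, mul_inv_cancel]
    rw [map_sum, freeCoaction_sym, vert_eq_sum R v hfin hne, Finset.sum_congr rfl fun f _ => hsum f]
    change MonoidAlgebra.singleAddHom _ (Unitization.inrHom R R _ _) = ∑ f ∈ _,
      MonoidAlgebra.singleAddHom _ (Unitization.inrHom R R _ _)
    rw [map_sum, map_sum]
    rfl
  | _ =>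
    -- Each of the other relations equates two words of the same degree, or a word with zero.
    simp [freeCoaction_sym, MonoidAlgebra.single_mul_single, ← Unitization.inr_mul, genDegree,
      vert_mul_self, vert_mul_of_ne, src_mul_edge, edge_mul_rng, rng_mul_ghost, ghost_mul_src,
      ghost_mul_edge_self, ghost_mul_edge_of_ne, *]

theorem freeCoaction_eq_of_mk_eq {a b : Leavitt.FreeAlg R E} (h : mk R E a = mk R E b) :
    freeCoaction R d a = freeCoaction R d b := by
  replace h : RingConGen.Rel (Leavitt.Rel R E) a b := Quotient.exact h
  induction h with
  | of _ _ h => exact freeCoaction_eq_of_rel R d h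
  | refl => rfl
  | symm _ ih => exact ih.symm
  | trans _ _ ih₁ ih₂ => exact ih₁.trans ih₂
  | add _ _ ih₁ ih₂ => rw [map_add, map_add, ih₁, ih₂]
  | mul _ _ ih₁ ih₂ => rw [map_mul, map_mul, ih₁, ih₂]

/-- The grading as a coaction on `L_R(E)`: a homogeneous element `x` of degree `g` is sent to `x`
times the group element `g`. -/
noncomputable def coaction :
    LeavittPathAlgebra R E →ₗ[R] MonoidAlgebra (Unitization R (LeavittPathAlgebra R E)) G where
  toFun := Quotient.lift (freeCoaction R d) fun _ _ h =>
    freeCoaction_eq_of_mk_eq R d (Quotient.sound h)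
  map_add' x y := by
    obtain ⟨a, rfl⟩ := mk_surjective R E x
    obtain ⟨b, rfl⟩ := mk_surjective R E y
    exact map_add (freeCoaction R d) a b
  map_smul' c x := by
    obtain ⟨a, rfl⟩ := mk_surjective R E x
    exact map_smul (freeCoaction R d) c a

theorem coaction_mkHom (a : Leavitt.FreeAlg R E) :
    coaction R d (mkHom R E a) = freeCoaction R d a := rfl

theorem coaction_of_mem_component {g : G} {x : LeavittPathAlgebra R E}
    (hx : x ∈ component R d g) :
    coaction R d x = MonoidAlgebra.single g (Unitization.inr x) := by
  induction hx using Submodule.span_induction with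
  | zero => simp
  | add _ _ _ _ h₁ h₂ =>
    rw [map_add, h₁, h₂, ← MonoidAlgebra.single_add, Unitization.inr_add]
  | smul c _ _ h => rw [map_smul, h, MonoidAlgebra.smul_single, Unitization.inr_smul]
  | mem _ hx =>
    obtain ⟨w, rfl, rfl⟩ := hx
    have h := mkHom_single R w 1
    rw [one_smul] at h
    rw [← h, coaction_mkHom, freeCoaction_single, one_smul, h]

/-- The independence of the components is read off from the coefficients of the coaction, and
they span since words in the generators span `L_R(E)`. -/
theorem isGroupGrading_component :
    IsGroupGrading (fun g : G => (component R d g).toAddSubgroup) where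
  mul_mem := mul_mem_component
  iSup_eq_top := by
    refine eq_top_iff.2 fun x _ => ?_
    obtain ⟨a, rfl⟩ := mk_surjective R E x
    change mkHom R E a ∈ _
    induction a using MonoidAlgebra.induction_linear with
    | zero => rw [map_zero]; exact zero_mem _
    | add _ _ h₁ h₂ =>
      rw [map_add]; exact add_mem (h₁ (AddSubgroup.mem_top _)) (h₂ (AddSubgroup.mem_top _))
    | single w c =>
      rw [mkHom_single]
      exact AddSubgroup.mem_iSup_of_mem (FreeSemigroup.lift (genDegree d) w)
        (Submodule.smul_mem (component R d _) c (lift_gen_mem_component R d w))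
  indep := by
    intro g
    rw [AddSubgroup.disjoint_def]
    intro x hx hx'
    let K : AddSubgroup (LeavittPathAlgebra R E) :=
      { carrier := {y | (coaction R d y).coeff g = 0}
        zero_mem' := by simp
        add_mem' := fun {y z} hy hz => by
          simp only [Set.mem_ofPred_eq] at hy hz
          simp [hy, hz]
        neg_mem' := fun {y} hy => by
          simp only [Set.mem_ofPred_eq] at hy
          simp [hy] }
    have hK : ⨆ (h) (_ : h ≠ g), (component R d h).toAddSubgroup ≤ K := by
      refine iSup₂_le fun h hh y hy => ?_
      change (coaction R d y).coeff g = 0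
      rw [coaction_of_mem_component R d hy]
      simp [hh]
    have key : (coaction R d x).coeff g = 0 := hK hx'
    rw [coaction_of_mem_component R d hx] at key
    exact Unitization.inr_injective (by simpa using key)

end Grading

end LeavittPathAlgebra

namespace LeavittPathAlgebra

open DirectedGraph Quiver

/-! ### Products of paths and ghost paths -/

section Paths

variable (R : Type*) [CommRing R] {E : DirectedGraph} {a b c : E.Vert}

theorem ofPath_nil : ofPath R (.nil : Path a a) = gen R (.vert a) := rfl

theorem ofPath_cons (p : Path a b) (f : b ⟶ c) :
    ofPath R (p.cons f) = ofPath R p * gen R (.edge f.1) := rfl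

theorem ofGhostPath_cons (p : Path a b) (f : b ⟶ c) :
    ofGhostPath R (p.cons f) = gen R (.ghost f.1) * ofGhostPath R p := rfl

theorem vert_mul_edge (f : a ⟶ b) : gen R (.vert a) * gen R (.edge f.1) = gen R (.edge f.1) := by
  obtain ⟨f, rfl, rfl⟩ := f
  exact src_mul_edge R f

theorem edge_mul_vert (f : a ⟶ b) : gen R (.edge f.1) * gen R (.vert b) = gen R (.edge f.1) := by
  obtain ⟨f, rfl, rfl⟩ := f
  exact edge_mul_rng R f

theorem vert_mul_ghost (f : a ⟶ b) :
    gen R (.vert b) * gen R (.ghost f.1) = gen R (.ghost f.1) := by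
  obtain ⟨f, rfl, rfl⟩ := f
  exact rng_mul_ghost R f

theorem ghost_mul_vert (f : a ⟶ b) :
    gen R (.ghost f.1) * gen R (.vert a) = gen R (.ghost f.1) := by
  obtain ⟨f, rfl, rfl⟩ := f
  exact ghost_mul_src R f

theorem ghost_mul_edge (f : a ⟶ b) : gen R (.ghost f.1) * gen R (.edge f.1) = gen R (.vert b) := by
  obtain ⟨f, rfl, rfl⟩ := f
  exact ghost_mul_edge_self R f

theorem vert_mul_ofPath (p : Path a b) : gen R (.vert a) * ofPath R p = ofPath R p := by
  induction p with
  | nil => exact vert_mul_self R a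
  | cons p f ih => rw [ofPath_cons, ← mul_assoc, ih]

theorem ofPath_mul_vert (p : Path a b) : ofPath R p * gen R (.vert b) = ofPath R p := by
  cases p with
  | nil => exact vert_mul_self R a
  | cons p f => rw [ofPath_cons, mul_assoc, edge_mul_vert]

theorem vert_mul_ofGhostPath (p : Path a b) :
    gen R (.vert b) * ofGhostPath R p = ofGhostPath R p := by
  cases p with
  | nil => exact vert_mul_self R a
  | cons p f => rw [ofGhostPath_cons, ← mul_assoc, vert_mul_ghost]

theorem ofGhostPath_mul_vert (p : Path a b) :
    ofGhostPath R p * gen R (.vert a) = ofGhostPath R p := by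
  induction p with
  | nil => exact vert_mul_self R a
  | cons p f ih => rw [ofGhostPath_cons, mul_assoc, ih]

theorem ofGhostPath_mul_ofPath_self (p : Path a b) :
    ofGhostPath R p * ofPath R p = gen R (.vert b) := by
  induction p with
  | nil => exact vert_mul_self R a
  | cons p f ih =>
    rw [ofGhostPath_cons, ofPath_cons, mul_assoc, ← mul_assoc (ofGhostPath R p), ih,
      vert_mul_edge, ghost_mul_edge]

theorem ofPath_comp (p : Path a b) (q : Path b c) :
    ofPath R (p.comp q) = ofPath R p * ofPath R q := by
  induction q with
  | nil => exact (ofPath_mul_vert R p).symm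
  | cons q f ih => rw [Path.comp_cons, ofPath_cons, ofPath_cons, ih, mul_assoc]

theorem ofGhostPath_comp (p : Path a b) (q : Path b c) :
    ofGhostPath R (p.comp q) = ofGhostPath R q * ofGhostPath R p := by
  induction q with
  | nil => exact (vert_mul_ofGhostPath R p).symm
  | cons q f ih => rw [Path.comp_cons, ofGhostPath_cons, ofGhostPath_cons, ih, mul_assoc]

theorem ofPath_toPath (f : a ⟶ b) : ofPath R f.toPath = gen R (.edge f.1) :=
  vert_mul_edge R f

theorem ofGhostPath_toPath (f : a ⟶ b) : ofGhostPath R f.toPath = gen R (.ghost f.1) :=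
  ghost_mul_vert R f

theorem pathDegree_comp {G : Type*} [Group G] (d : E.Edge → G) (p : Path a b) (q : Path b c) :
    pathDegree d (p.comp q) = pathDegree d p * pathDegree d q := by
  induction q with
  | nil => exact (mul_one _).symm
  | cons q f ih => rw [Path.comp_cons, pathDegree, pathDegree, ih, mul_assoc]

theorem pathDegree_toPath {G : Type*} [Group G] (d : E.Edge → G) (f : a ⟶ b) :
    pathDegree d f.toPath = d f.1 :=
  one_mul _

/-- For two paths `p`, `q` with the same source, `p* q` vanishes unless one of the two is an
initial segment of the other. -/
theorem ofGhostPath_mul_ofPath_eq_zero_or (p : Path a b) (q : Path a c) :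
    ofGhostPath R p * ofPath R q = 0 ∨ (∃ q', q = p.comp q') ∨ ∃ p', p = q.comp p' := by
  induction q with
  | nil => exact .inr (.inr ⟨p, (Path.nil_comp p).symm⟩)
  | cons q g ih =>
    obtain h | ⟨q', rfl⟩ | ⟨p', rfl⟩ := ih
    · exact .inl (by rw [ofPath_cons, ← mul_assoc, h, zero_mul])
    · exact .inr (.inl ⟨q'.cons g, rfl⟩)
    · obtain h0 | h0 := eq_or_ne p'.length 0
      · obtain rfl := Path.eq_of_length_zero p' h0
        obtain rfl := Path.eq_nil_of_length_zero p' h0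
        exact .inr (.inl ⟨g.toPath, rfl⟩)
      · obtain ⟨v, f, p'', rfl, -⟩ := (Path.length_ne_zero_iff_eq_comp p').1 h0
        by_cases hfg : f.1 = g.1
        · obtain ⟨f, hf, rfl⟩ := f
          obtain ⟨g, hg, rfl⟩ := g
          obtain rfl : f = g := hfg
          exact .inr (.inr ⟨p'', by rw [← Path.comp_assoc, Path.comp_toPath_eq_cons]⟩)
        · left
          rw [ofGhostPath_comp, ofGhostPath_comp, ofGhostPath_toPath, ofPath_cons, mul_assoc,
            ← mul_assoc (ofGhostPath R q), ofGhostPath_mul_ofPath_self, vert_mul_edge, mul_assoc,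
            ghost_mul_edge_of_ne R hfg, mul_zero]

/-- The idempotent of an extension of `p` lies below the idempotent `p p*`. -/
theorem mul_idempotent_comp (p : Path a b) (q : Path b c) :
    ofPath R p * ofGhostPath R p * (ofPath R (p.comp q) * ofGhostPath R (p.comp q)) =
        ofPath R (p.comp q) * ofGhostPath R (p.comp q) ∧
      ofPath R (p.comp q) * ofGhostPath R (p.comp q) * (ofPath R p * ofGhostPath R p) =
        ofPath R (p.comp q) * ofGhostPath R (p.comp q) := by
  have h₁ : ofPath R p * ofGhostPath R p * ofPath R p = ofPath R p := by
    rw [mul_assoc, ofGhostPath_mul_ofPath_self, ofPath_mul_vert]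
  have h₂ : ofGhostPath R p * (ofPath R p * ofGhostPath R p) = ofGhostPath R p := by
    rw [← mul_assoc, ofGhostPath_mul_ofPath_self, vert_mul_ofGhostPath]
  rw [ofPath_comp, ofGhostPath_comp]
  constructor
  · rw [mul_assoc (ofPath R p) (ofPath R q), ← mul_assoc _ (ofPath R p), h₁]
  · rw [mul_assoc, mul_assoc _ (ofGhostPath R p), h₂]

/-- The idempotents `p p*` commute with each other: they are orthogonal unless one of the two paths
extends the other, in which case the product in either order is the idempotent of the longer one. -/
theorem ofPath_mul_ofGhostPath_commute {a' b' : E.Vert} (p : Path a b) (q : Path a' b') :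
    ofPath R p * ofGhostPath R p * (ofPath R q * ofGhostPath R q) =
      ofPath R q * ofGhostPath R q * (ofPath R p * ofGhostPath R p) := by
  have hzero {a b a' b' : E.Vert} (p : Path a b) (q : Path a' b')
      (h : ofGhostPath R p * ofPath R q = 0) :
      ofPath R p * ofGhostPath R p * (ofPath R q * ofGhostPath R q) = 0 := by
    rw [mul_assoc, ← mul_assoc (ofGhostPath R p), h, zero_mul, mul_zero]
  have hsrc {a b a' b' : E.Vert} (p : Path a b) (q : Path a' b') (h : a ≠ a') :
      ofGhostPath R p * ofPath R q = 0 := by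
    rw [← ofGhostPath_mul_vert R p, ← vert_mul_ofPath R q, mul_assoc,
      ← mul_assoc (gen R (.vert a)), vert_mul_of_ne R h, zero_mul, mul_zero]
  by_cases ha : a = a'
  · subst ha
    obtain h | ⟨q', rfl⟩ | ⟨p', rfl⟩ := ofGhostPath_mul_ofPath_eq_zero_or R p q
    · obtain h' | ⟨q', rfl⟩ | ⟨p', rfl⟩ := ofGhostPath_mul_ofPath_eq_zero_or R q p
      · rw [hzero p q h, hzero q p h']
      · rw [(mul_idempotent_comp R q q').1, (mul_idempotent_comp R q q').2]
      · rw [(mul_idempotent_comp R p p').1, (mul_idempotent_comp R p p').2]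
    · rw [(mul_idempotent_comp R p q').1, (mul_idempotent_comp R p q').2]
    · rw [(mul_idempotent_comp R q p').1, (mul_idempotent_comp R q p').2]
  · rw [hzero p q (hsrc p q ha), hzero q p (hsrc q p (Ne.symm ha))]

end Paths

/-! ### The monomials span the components -/

section Monomials

variable (R : Type*) [CommRing R] {E : DirectedGraph} {G : Type*} [Group G] (d : E.Edge → G)

theorem ofPath_mem_component {a b : E.Vert} (p : Path a b) :
    ofPath R p ∈ component R d (pathDegree d p) := by
  induction p with
  | nil => exact gen_mem_component R d (.vert a)
  | cons p f ih => exact mul_mem_component ih (gen_mem_component R d (.edge f.1))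

theorem ofGhostPath_mem_component {a b : E.Vert} (p : Path a b) :
    ofGhostPath R p ∈ component R d (pathDegree d p)⁻¹ := by
  induction p with
  | nil =>
    rw [pathDegree, inv_one]
    exact gen_mem_component R d (.vert a)
  | cons p f ih =>
    rw [pathDegree, mul_inv_rev]
    exact mul_mem_component (gen_mem_component R d (.ghost f.1)) ih

theorem ofPath_mul_ofGhostPath_mem_component {a b a' b' : E.Vert} (p : Path a b)
    (q : Path a' b') :
    ofPath R p * ofGhostPath R q ∈ component R d (pathDegree d p * (pathDegree d q)⁻¹) :=
  mul_mem_component (ofPath_mem_component R d p) (ofGhostPath_mem_component R d q)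

theorem ofPath_mul_ofGhostPath_of_ne {a b a' b' : E.Vert} (p : Path a b) (q : Path a' b')
    (h : b ≠ b') : ofPath R p * ofGhostPath R q = 0 := by
  rw [← ofPath_mul_vert R p, ← vert_mul_ofGhostPath R q, mul_assoc,
    ← mul_assoc (gen R (.vert b)), vert_mul_of_ne R h, zero_mul, mul_zero]

variable {d}

theorem mem_monomials {a b a' b' : E.Vert} (p : Path a b) (q : Path a' b') {g : G}
    (h : pathDegree d p * (pathDegree d q)⁻¹ = g) :
    ofPath R p * ofGhostPath R q ∈ Submodule.span R (monomials R d g) :=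
  Submodule.subset_span ⟨a, b, a', b', p, q, h, rfl⟩

theorem gen_mem_span_monomials (x : E.Gen) :
    gen R x ∈ Submodule.span R (monomials R d (genDegree d x)) := by
  cases x with
  | vert v =>
    rw [← vert_mul_self]
    exact mem_monomials R (.nil : Path v v) (.nil : Path v v) (by simp [pathDegree, genDegree])
  | edge f =>
    let e : E.src f ⟶ E.rng f := ⟨f, rfl, rfl⟩
    rw [← edge_mul_rng, ← ofPath_toPath R e]
    exact mem_monomials R e.toPath (.nil : Path (E.rng f) _)
      (by simp [pathDegree_toPath, pathDegree, genDegree, e])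
  | ghost f =>
    let e : E.src f ⟶ E.rng f := ⟨f, rfl, rfl⟩
    rw [← rng_mul_ghost, ← ofGhostPath_toPath R e]
    exact mem_monomials R (.nil : Path (E.rng f) _) e.toPath
      (by simp [pathDegree_toPath, pathDegree, genDegree, e])

/-- Multiplication by a generator on the left sends `p q*` to zero or to an element of the same
form: `v` fixes or kills it, `f` extends `p`, and `f*` either shortens `p` or, when `p` is a
vertex, extends `q`. -/
theorem gen_mul_mem_span_monomials (x : E.Gen) {a b a' b' : E.Vert} (p : Path a b)
    (q : Path a' b') :
    gen R x * (ofPath R p * ofGhostPath R q) ∈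
      Submodule.span R (monomials R d
        (genDegree d x * (pathDegree d p * (pathDegree d q)⁻¹))) := by
  have hvert (v : E.Vert) (h : v ≠ a) : gen R (.vert v) * (ofPath R p * ofGhostPath R q) = 0 := by
    rw [← vert_mul_ofPath R p, ← mul_assoc, ← mul_assoc, vert_mul_of_ne R h, zero_mul, zero_mul]
  cases x with
  | vert v =>
    by_cases h : v = a
    · subst h
      rw [← mul_assoc (gen R _), vert_mul_ofPath]
      exact mem_monomials R p q (one_mul _).symm
    · rw [hvert v h]
      exact zero_mem _
  | edge f =>
    by_cases h : E.rng f = a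
    · subst h
      let e : E.src f ⟶ E.rng f := ⟨f, rfl, rfl⟩
      rw [← mul_assoc (gen R _), ← ofPath_toPath R e, ← ofPath_comp]
      exact mem_monomials R _ q
        (by simp [pathDegree_comp, pathDegree_toPath, genDegree, e, mul_assoc])
    · rw [← edge_mul_rng, mul_assoc, hvert _ h, mul_zero]
      exact zero_mem _
  | ghost f =>
    by_cases h : E.src f = a
    · subst h
      let e : E.src f ⟶ E.rng f := ⟨f, rfl, rfl⟩
      obtain h0 | h0 := eq_or_ne p.length 0
      · obtain rfl := Path.eq_of_length_zero p h0
        obtain rfl := Path.eq_nil_of_length_zero p h0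
        by_cases hb : E.src f = b'
        · subst hb
          rw [ofPath_nil, ← mul_assoc (gen R _), ghost_mul_src, ← rng_mul_ghost,
            mul_assoc (gen R _), ← ofGhostPath_cons R q e]
          exact mem_monomials R (.nil : Path (E.rng f) _) (q.cons e)
            (by simp [pathDegree, genDegree, e])
        · rw [ofPath_mul_ofGhostPath_of_ne R _ q hb, mul_zero]
          exact zero_mem _
      · obtain ⟨v, f', p', rfl, -⟩ := (Path.length_ne_zero_iff_eq_comp p).1 h0
        rw [ofPath_comp, ofPath_toPath, mul_assoc (gen R _), ← mul_assoc (gen R _)]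
        by_cases hf : f = f'.1
        · obtain ⟨f', hs, rfl⟩ := f'
          obtain rfl : f = f' := hf
          rw [ghost_mul_edge_self, ← mul_assoc (gen R _), vert_mul_ofPath]
          exact mem_monomials R p' q
            (by simp [pathDegree_comp, pathDegree_toPath, genDegree, mul_assoc])
        · rw [ghost_mul_edge_of_ne R hf, zero_mul]
          exact zero_mem _
    · rw [← ghost_mul_src, mul_assoc, hvert _ h, mul_zero]
      exact zero_mem _

theorem component_eq_span_monomials (g : G) :
    component R d g = Submodule.span R (monomials R d g) := by
  apply le_antisymm
  · rw [component, Submodule.span_le]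
    rintro _ ⟨w, rfl, rfl⟩
    induction w with
    | ih1 x => exact gen_mem_span_monomials R x
    | ih2 x w _ hw =>
      rw [map_mul, map_mul, FreeSemigroup.lift_of, FreeSemigroup.lift_of]
      generalize FreeSemigroup.lift (gen R) w = y at hw
      induction hw using Submodule.span_induction with
      | zero => rw [mul_zero]; exact zero_mem _
      | add _ _ _ _ h₁ h₂ => rw [mul_add]; exact add_mem h₁ h₂
      | smul c _ _ h => rw [mul_smul_comm]; exact Submodule.smul_mem _ c h
      | mem y hy =>
        obtain ⟨a, b, a', b', p, q, hpq, rfl⟩ := hy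
        rw [← hpq]
        exact gen_mul_mem_span_monomials R x p q
  · rw [Submodule.span_le]
    rintro _ ⟨a, b, a', b', p, q, rfl, rfl⟩
    exact ofPath_mul_ofGhostPath_mem_component R d p q

end Monomials

end LeavittPathAlgebra

/-! ### Common local identities -/

section LocalUnits

variable {S : Type*} [NonUnitalRing S]

theorem mul_mem_addSubgroupProd {A B : AddSubgroup S} {a b : S} (ha : a ∈ A) (hb : b ∈ B) :
    a * b ∈ addSubgroupProd A B :=
  AddSubgroup.subset_closure ⟨a, ha, b, hb, rfl⟩

variable {D : NonUnitalSubring S}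

/-- If the elements of `D` commute, then `x = e₁ x` and `y = e₂ y` imply that `e₁ + e₂ - e₁ e₂`
is a left identity on both `x` and `y`. -/
theorem exists_common_left_unit (hD : ∀ x ∈ D, ∀ y ∈ D, x * y = y * x) {x y : S}
    (hx : ∃ e ∈ D, e * x = x) (hy : ∃ e ∈ D, e * y = y) :
    ∃ e ∈ D, e * x = x ∧ e * y = y := by
  obtain ⟨e₁, h₁, hx⟩ := hx
  obtain ⟨e₂, h₂, hy⟩ := hy
  refine ⟨e₁ + e₂ - e₁ * e₂, sub_mem (add_mem h₁ h₂) (mul_mem h₁ h₂), ?_, ?_⟩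
  · rw [sub_mul, add_mul, hD _ h₁ _ h₂, mul_assoc, hx, add_sub_cancel_right]
  · rw [sub_mul, add_mul, mul_assoc, hy, add_sub_cancel_left]

theorem exists_common_right_unit (hD : ∀ x ∈ D, ∀ y ∈ D, x * y = y * x) {F : Finset S}
    (hF : ∀ x ∈ F, ∃ e ∈ D, x * e = x) : ∃ e ∈ D, ∀ x ∈ F, x * e = x := by
  classical
  induction F using Finset.induction_on with
  | empty => exact ⟨0, zero_mem D, by simp⟩
  | insert x F _ ih =>
    obtain ⟨e₁, h₁, hx⟩ := hF x (Finset.mem_insert_self x F)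
    obtain ⟨e₂, h₂, hy⟩ := ih fun y hy => hF y (Finset.mem_insert_of_mem hy)
    refine ⟨e₁ + e₂ - e₁ * e₂, sub_mem (add_mem h₁ h₂) (mul_mem h₁ h₂), fun y hyF => ?_⟩
    obtain rfl | hyF := Finset.mem_insert.1 hyF
    · rw [mul_sub, mul_add, ← mul_assoc, hx, add_sub_cancel_right]
    · rw [mul_sub, mul_add, hD _ h₁ _ h₂, ← mul_assoc, hy y hyF, add_sub_cancel_left]

end LocalUnits

/-! ### Epsilon-strong gradings have finitely generated components -/

section Graded

variable {S : Type*} [NonUnitalRing S] {G : Type*} [Group G] {𝒮 : G → AddSubgroup S}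

namespace IsGroupGrading

theorem mul_mul_mem (h𝒮 : IsGroupGrading 𝒮) {g : G} {x y z : S} (hx : x ∈ 𝒮 g)
    (hy : y ∈ 𝒮 g⁻¹) (hz : z ∈ 𝒮 g) : x * y * z ∈ 𝒮 g := by
  simpa using h𝒮.mul_mem (h𝒮.mul_mem hx hy) hz

theorem prod_mul_mem (h𝒮 : IsGroupGrading 𝒮) {g : G} {x y : S}
    (hx : x ∈ addSubgroupProd (𝒮 g) (𝒮 g⁻¹)) (hy : y ∈ addSubgroupProd (𝒮 g) (𝒮 g⁻¹)) :
    x * y ∈ addSubgroupProd (𝒮 g) (𝒮 g⁻¹) := by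
  induction hx using AddSubgroup.closure_induction with
  | zero => rw [zero_mul]; exact zero_mem _
  | add _ _ _ _ h₁ h₂ => rw [add_mul]; exact add_mem h₁ h₂
  | neg _ _ h => rw [neg_mul]; exact neg_mem h
  | mem _ hx =>
    obtain ⟨a, ha, b, hb, rfl⟩ := hx
    induction hy using AddSubgroup.closure_induction with
    | zero => rw [mul_zero]; exact zero_mem _
    | add _ _ _ _ h₁ h₂ => rw [mul_add]; exact add_mem h₁ h₂
    | neg _ _ h => rw [mul_neg]; exact neg_mem h
    | mem _ hy =>
      obtain ⟨a', ha', b', hb', rfl⟩ := hy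
      rw [← mul_assoc]
      exact mul_mem_addSubgroupProd (h𝒮.mul_mul_mem ha hb ha') hb'

/-- If `x = Σ aᵢ bᵢ` with `aᵢ` of degree `g⁻¹` and `bᵢ` of degree `g`, then the finitely many `bᵢ`
generate all elements `s x` with `s` of degree `g` over the principal component. -/
theorem exists_finset_mul_mem_closure (h𝒮 : IsGroupGrading 𝒮) {g : G} {x : S}
    (hx : x ∈ addSubgroupProd (𝒮 g⁻¹) (𝒮 g)) :
    ∃ F : Finset S, (∀ y ∈ F, y ∈ 𝒮 g) ∧
      ∀ s ∈ 𝒮 g, s * x ∈ AddSubgroup.closure {y | ∃ a ∈ 𝒮 1, ∃ x ∈ F, a * x = y} := by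
  classical
  induction hx using AddSubgroup.closure_induction with
  | zero => exact ⟨∅, by simp, fun s _ => by rw [mul_zero]; exact zero_mem _⟩
  | neg _ _ h =>
    obtain ⟨F, hF, h⟩ := h
    exact ⟨F, hF, fun s hs => by rw [mul_neg]; exact neg_mem (h s hs)⟩
  | add _ _ _ _ h₁ h₂ =>
    obtain ⟨F₁, hF₁, h₁⟩ := h₁
    obtain ⟨F₂, hF₂, h₂⟩ := h₂
    refine ⟨F₁ ∪ F₂, fun y hy => (Finset.mem_union.1 hy).elim (hF₁ y) (hF₂ y), fun s hs => ?_⟩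
    rw [mul_add]
    refine add_mem (AddSubgroup.closure_mono ?_ (h₁ s hs)) (AddSubgroup.closure_mono ?_ (h₂ s hs))
    · rintro _ ⟨a, ha, x, hx, rfl⟩
      exact ⟨a, ha, x, Finset.mem_union_left _ hx, rfl⟩
    · rintro _ ⟨a, ha, x, hx, rfl⟩
      exact ⟨a, ha, x, Finset.mem_union_right _ hx, rfl⟩
  | mem _ hx =>
    obtain ⟨a, ha, b, hb, rfl⟩ := hx
    refine ⟨{b}, by simpa using hb, fun s hs => ?_⟩
    rw [← mul_assoc]
    refine AddSubgroup.subset_closure ⟨s * a, ?_, b, Finset.mem_singleton_self b, rfl⟩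
    simpa using h𝒮.mul_mem hs ha

end IsGroupGrading

theorem IsEpsilonStronglyGraded.isLeftFinitelyGenerated (h : IsEpsilonStronglyGraded 𝒮) (g : G) :
    IsLeftFinitelyGenerated (𝒮 1) (𝒮 g) := by
  obtain ⟨e, he, hge⟩ := (h.unital_bimodule g).2
  obtain ⟨F, hF, hFe⟩ := h.grading.exists_finset_mul_mem_closure he
  refine ⟨F, le_antisymm (fun s hs => ?_) ((AddSubgroup.closure_le _).2 ?_)⟩
  · rw [← hge s hs]
    exact AddSubgroup.closure_mono Set.subset_union_right (hFe s hs)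
  · rintro y (hy | ⟨a, ha, x, hx, rfl⟩)
    · exact hF y hy
    · simpa using h.grading.mul_mem ha (hF x hx)

end Graded

/-! ### Local identities in the Leavitt path algebra -/

namespace LeavittPathAlgebra

open DirectedGraph Quiver

variable (R : Type*) [CommRing R] {E : DirectedGraph} {G : Type*} [Group G] (d : E.Edge → G)

/-- The idempotents `p p*` of the paths `p` for which there is a path `q` with the same range such
that `p q*` has degree `g`. -/
def pathIdempotents (g : G) : Set (LeavittPathAlgebra R E) :=
  {x | ∃ (a b c : E.Vert) (p : Path a b) (q : Path c b),
    pathDegree d p * (pathDegree d q)⁻¹ = g ∧ ofPath R p * ofGhostPath R p = x}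

/-- The ring generated by the idempotents `p p*` with `p` as in `pathIdempotents`. It supplies the
local left identities of the component of degree `g`, and the local right identities of the
component of degree `g⁻¹`. -/
noncomputable def localUnits (g : G) : NonUnitalSubring (LeavittPathAlgebra R E) :=
  NonUnitalSubring.closure (pathIdempotents R d g)

variable {d}

theorem localUnits_comm {g : G} : ∀ x ∈ localUnits R d g, ∀ y ∈ localUnits R d g,
    x * y = y * x := by
  intro x hx y hy
  induction hx, hy using NonUnitalSubring.closure_induction₂ with
  | mem_mem _ _ hx hy =>
    obtain ⟨a, b, c, p, q, -, rfl⟩ := hx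
    obtain ⟨a', b', c', p', q', -, rfl⟩ := hy
    exact ofPath_mul_ofGhostPath_commute R p p'
  | zero_left => simp
  | zero_right => simp
  | neg_left _ _ _ _ h => simp [h]
  | neg_right _ _ _ _ h => simp [h]
  | add_left _ _ _ _ _ _ h₁ h₂ => rw [add_mul, mul_add, h₁, h₂]
  | add_right _ _ _ _ _ _ h₁ h₂ => rw [add_mul, mul_add, h₁, h₂]
  | mul_left x y z _ _ _ h₁ h₂ => rw [mul_assoc, h₂, ← mul_assoc, h₁, mul_assoc]
  | mul_right x y z _ _ _ h₁ h₂ => rw [← mul_assoc, h₁, mul_assoc, h₂, mul_assoc]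

theorem mem_addSubgroupProd_of_mem_localUnits {g : G} {x : LeavittPathAlgebra R E}
    (hx : x ∈ localUnits R d g) :
    x ∈ addSubgroupProd (component R d g).toAddSubgroup (component R d g⁻¹).toAddSubgroup := by
  induction hx using NonUnitalSubring.closure_induction with
  | zero => exact zero_mem _
  | add _ _ _ _ h₁ h₂ => exact add_mem h₁ h₂
  | neg _ _ h => exact neg_mem h
  | mul _ _ _ _ h₁ h₂ => exact (isGroupGrading_component R d).prod_mul_mem h₁ h₂
  | mem _ hx =>
    obtain ⟨a, b, c, p, q, rfl, rfl⟩ := hx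
    have h : ofPath R p * ofGhostPath R p =
        ofPath R p * ofGhostPath R q * (ofPath R q * ofGhostPath R p) := by
      rw [mul_assoc, ← mul_assoc (ofGhostPath R q), ofGhostPath_mul_ofPath_self,
        vert_mul_ofGhostPath]
    rw [h]
    refine mul_mem_addSubgroupProd (ofPath_mul_ofGhostPath_mem_component R d p q) ?_
    simpa using ofPath_mul_ofGhostPath_mem_component R d q p

theorem exists_left_unit {g : G} {x : LeavittPathAlgebra R E} (hx : x ∈ component R d g) :
    ∃ e ∈ localUnits R d g, e * x = x := by
  rw [component_eq_span_monomials] at hx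
  induction hx using Submodule.span_induction with
  | zero => exact ⟨0, zero_mem _, mul_zero 0⟩
  | smul c _ _ h =>
    obtain ⟨e, he, h⟩ := h
    exact ⟨e, he, by rw [mul_smul_comm, h]⟩
  | add _ _ _ _ h₁ h₂ =>
    obtain ⟨e, he, h₁, h₂⟩ := exists_common_left_unit (localUnits_comm R) h₁ h₂
    exact ⟨e, he, by rw [mul_add, h₁, h₂]⟩
  | mem _ hx =>
    obtain ⟨a, b, c, b', p, q, hpq, rfl⟩ := hx
    by_cases hb : b = b'
    · subst hb
      refine ⟨_, NonUnitalSubring.subset_closure ⟨a, b, c, p, q, hpq, rfl⟩, ?_⟩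
      rw [mul_assoc, ← mul_assoc (ofGhostPath R p), ofGhostPath_mul_ofPath_self,
        vert_mul_ofGhostPath]
    · exact ⟨0, zero_mem _, by rw [ofPath_mul_ofGhostPath_of_ne R p q hb, mul_zero]⟩

theorem exists_right_unit {g : G} {x : LeavittPathAlgebra R E} (hx : x ∈ component R d g) :
    ∃ e ∈ localUnits R d g⁻¹, x * e = x := by
  classical
  rw [component_eq_span_monomials] at hx
  induction hx using Submodule.span_induction with
  | zero => exact ⟨0, zero_mem _, mul_zero 0⟩
  | smul c _ _ h =>
    obtain ⟨e, he, h⟩ := h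
    exact ⟨e, he, by rw [smul_mul_assoc, h]⟩
  | add x y _ _ h₁ h₂ =>
    obtain ⟨e, he, h⟩ := exists_common_right_unit (localUnits_comm R) (F := {x, y})
      (by simpa using ⟨h₁, h₂⟩)
    exact ⟨e, he, by rw [add_mul, h x (by simp), h y (by simp)]⟩
  | mem _ hx =>
    obtain ⟨a, b, c, b', p, q, hpq, rfl⟩ := hx
    by_cases hb : b = b'
    · subst hb
      refine ⟨_, NonUnitalSubring.subset_closure ⟨c, b, a, q, p, ?_, rfl⟩, ?_⟩
      · rw [← hpq, mul_inv_rev, inv_inv]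
      · rw [mul_assoc, ← mul_assoc (ofGhostPath R q), ofGhostPath_mul_ofPath_self,
          vert_mul_ofGhostPath]
    · exact ⟨0, zero_mem _, by rw [ofPath_mul_ofGhostPath_of_ne R p q hb, zero_mul]⟩

theorem exists_right_unit_of_finset {g : G} {F : Finset (LeavittPathAlgebra R E)}
    (hF : ∀ x ∈ F, x ∈ component R d g) :
    ∃ e ∈ addSubgroupProd (component R d g⁻¹).toAddSubgroup (component R d g).toAddSubgroup,
      ∀ x ∈ F, x * e = x := by
  obtain ⟨e, he, h⟩ :=
    exists_common_right_unit (localUnits_comm R) fun x hx => exists_right_unit R (hF x hx)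
  have he' := mem_addSubgroupProd_of_mem_localUnits R he
  rw [inv_inv] at he'
  exact ⟨e, he', h⟩

/-- A right identity of the component of degree `g⁻¹` that lies in `L_g L_{g⁻¹}` is a left identity
of the component of degree `g`. -/
theorem left_unit_of_right_unit {g : G} {ε : LeavittPathAlgebra R E}
    (hε : ε ∈ addSubgroupProd (component R d g).toAddSubgroup (component R d g⁻¹).toAddSubgroup)
    (h : ∀ x ∈ component R d g⁻¹, x * ε = x) {x : LeavittPathAlgebra R E}
    (hx : x ∈ component R d g) : ε * x = x := by
  have hprod : ∀ y ∈ addSubgroupProd (component R d g).toAddSubgroup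
      (component R d g⁻¹).toAddSubgroup, y * ε = y ∧ ∃ e ∈ localUnits R d g, e * y = y := by
    intro y hy
    induction hy using AddSubgroup.closure_induction with
    | zero => exact ⟨zero_mul _, 0, zero_mem _, mul_zero 0⟩
    | add _ _ _ _ h₁ h₂ =>
      obtain ⟨e, he, h₃, h₄⟩ := exists_common_left_unit (localUnits_comm R) h₁.2 h₂.2
      exact ⟨by rw [add_mul, h₁.1, h₂.1], e, he, by rw [mul_add, h₃, h₄]⟩
    | neg _ _ h =>
      obtain ⟨h₁, e, he, h₂⟩ := h
      exact ⟨by rw [neg_mul, h₁], e, he, by rw [mul_neg, h₂]⟩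
    | mem _ hy =>
      obtain ⟨a, ha, b, hb, rfl⟩ := hy
      obtain ⟨e, he, hea⟩ := exists_left_unit R ha
      exact ⟨by rw [mul_assoc, h b hb], e, he, by rw [← mul_assoc, hea]⟩
  -- A local left identity `e` for both `ε` and `x` equals `e ε = ε`.
  obtain ⟨e, he, heε, hex⟩ :=
    exists_common_left_unit (localUnits_comm R) (hprod ε hε).2 (exists_left_unit R hx)
  have := (hprod e (mem_addSubgroupProd_of_mem_localUnits R he)).1
  rw [← heε, this, hex]

/-- A two-sided identity on the principal component is an identity of `L_R(E)`, since every
monomial starts and ends in a vertex. -/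
theorem identity_of_component_one {u : LeavittPathAlgebra R E}
    (h : ∀ x ∈ component R d 1, u * x = x ∧ x * u = x) (x : LeavittPathAlgebra R E) :
    u * x = x ∧ x * u = x := by
  have hx : x ∈ ⨆ g : G, (component R d g).toAddSubgroup := by
    rw [(isGroupGrading_component R d).iSup_eq_top]
    exact AddSubgroup.mem_top x
  have hv (v : E.Vert) := h _ (gen_mem_component R d (.vert v))
  induction hx using AddSubgroup.iSup_induction' with
  | h1 => exact ⟨mul_zero u, zero_mul u⟩
  | hadd _ _ _ _ h₁ h₂ => exact ⟨by rw [mul_add, h₁.1, h₂.1], by rw [add_mul, h₁.2, h₂.2]⟩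
  | hp g x hx =>
    replace hx : x ∈ component R d g := hx
    rw [component_eq_span_monomials] at hx
    induction hx using Submodule.span_induction with
    | zero => exact ⟨mul_zero u, zero_mul u⟩
    | add _ _ _ _ h₁ h₂ => exact ⟨by rw [mul_add, h₁.1, h₂.1], by rw [add_mul, h₁.2, h₂.2]⟩
    | smul c _ _ h => exact ⟨by rw [mul_smul_comm, h.1], by rw [smul_mul_assoc, h.2]⟩
    | mem _ hx =>
      obtain ⟨a, b, a', b', p, q, -, rfl⟩ := hx
      constructor
      · rw [← vert_mul_ofPath R p, ← mul_assoc, ← mul_assoc, (hv a).1]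
      · rw [← ofGhostPath_mul_vert R q, mul_assoc, mul_assoc, (hv a').2]

theorem isEpsilonStronglyGraded_of_right_units
    (h : ∀ g : G, ∃ e ∈ addSubgroupProd (component R d g⁻¹).toAddSubgroup
      (component R d g).toAddSubgroup, ∀ x ∈ component R d g, x * e = x) :
    IsEpsilonStronglyGraded (fun g : G => (component R d g).toAddSubgroup) where
  grading := isGroupGrading_component R d
  unital_bimodule g := by
    refine ⟨?_, h g⟩
    obtain ⟨e, he, hge⟩ := h g⁻¹
    rw [inv_inv] at he
    exact ⟨e, he, fun x hx => left_unit_of_right_unit R he hge hx⟩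
  unital := by
    obtain ⟨u, hu, hr⟩ := h 1
    refine ⟨u, identity_of_component_one R (d := d) fun x hx => ⟨?_, hr x hx⟩⟩
    refine left_unit_of_right_unit R (d := d) (g := 1) ?_ ?_ hx
    · rwa [inv_one] at hu ⊢
    · rwa [inv_one]

theorem isEpsilonStronglyGraded_of_isLeftFinitelyGenerated
    (h : ∀ g : G, IsLeftFinitelyGenerated (component R d 1).toAddSubgroup
      (component R d g).toAddSubgroup) :
    IsEpsilonStronglyGraded (fun g : G => (component R d g).toAddSubgroup) := by
  refine isEpsilonStronglyGraded_of_right_units R fun g => ?_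
  obtain ⟨F, hF⟩ := h g
  have hFg : ∀ x ∈ F, x ∈ component R d g := fun x hx => by
    rw [← Submodule.mem_toAddSubgroup, hF]
    exact AddSubgroup.subset_closure (.inl hx)
  obtain ⟨e, he, hFe⟩ := exists_right_unit_of_finset R hFg
  refine ⟨e, he, fun x hx => ?_⟩
  rw [← Submodule.mem_toAddSubgroup, hF] at hx
  induction hx using AddSubgroup.closure_induction with
  | zero => exact zero_mul e
  | add _ _ _ _ h₁ h₂ => rw [add_mul, h₁, h₂]
  | neg _ _ h => rw [neg_mul, h]
  | mem x hx =>
    obtain hx | ⟨a, -, y, hy, rfl⟩ := hx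
    · exact hFe x hx
    · rw [mul_assoc, hFe y hy]

theorem isEpsilonStronglyGraded_of_fg (h : ∀ g : G, (component R d g).FG) :
    IsEpsilonStronglyGraded (fun g : G => (component R d g).toAddSubgroup) := by
  refine isEpsilonStronglyGraded_of_right_units R fun g => ?_
  obtain ⟨F, hF⟩ := h g
  obtain ⟨e, he, hFe⟩ := exists_right_unit_of_finset R (d := d) (g := g) (F := F)
    fun x hx => hF ▸ Submodule.subset_span hx
  refine ⟨e, he, fun x hx => ?_⟩
  rw [← hF] at hx
  induction hx using Submodule.span_induction with
  | zero => exact zero_mul e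
  | add _ _ _ _ h₁ h₂ => rw [add_mul, h₁, h₂]
  | smul c _ _ h => rw [smul_mul_assoc, h]
  | mem x hx => exact hFe x hx

end LeavittPathAlgebra

theorem proposition5p2 (R : Type*) [CommRing R] (E : DirectedGraph) (G : Type*) [Group G]
    (d : E.Edge → G) :
    IsGroupGrading (fun g : G => (LeavittPathAlgebra.component R d g).toAddSubgroup) ∧
    (∀ g : G, LeavittPathAlgebra.component R d g =
      Submodule.span R (LeavittPathAlgebra.monomials R d g)) ∧
    (IsEpsilonStronglyGraded
        (fun g : G => (LeavittPathAlgebra.component R d g).toAddSubgroup) ↔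
      ∀ g : G, IsLeftFinitelyGenerated
        (LeavittPathAlgebra.component R d 1).toAddSubgroup
        (LeavittPathAlgebra.component R d g).toAddSubgroup) ∧
    ((∀ g : G, (LeavittPathAlgebra.component R d g).FG) →
      IsEpsilonStronglyGraded
        (fun g : G => (LeavittPathAlgebra.component R d g).toAddSubgroup)) := by
  exact ⟨LeavittPathAlgebra.isGroupGrading_component R d,
    LeavittPathAlgebra.component_eq_span_monomials R,
    ⟨fun h g => h.isLeftFinitelyGenerated g,
      LeavittPathAlgebra.isEpsilonStronglyGraded_of_isLeftFinitelyGenerated R⟩,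
    LeavittPathAlgebra.isEpsilonStronglyGraded_of_fg R⟩
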